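/- **Theorem 1.1.** Let $\mathbb K$ be a field of characteristic zero. A line arrangement in $\mathbb P^2=\mathbb P(\mathbb K^3)$ is a finite set $\mathcal A$ of lines. An intersection point of $\mathcal A$ is a point lying on at least two distinct lines of $\mathcal A$; its multiplicity is the number of lines of $\mathcal A$ through it. An intersection point $p$ is modular if for every intersection point $q\ne p$ the line $\overline{pq}$ belongs to $\mathcal A$, and $\mathcal A$ is supersolvable if it has a modular point. (a) Let $\mathcal A$ be a supersolvable line arrangement in $\mathbb P^2$, and let $p$ be a modular point of $\mathcal A$ whose multiplicity $m\ge 2$ is maximal among the multiplicities of the modular points of $\mathcal A$. Then $d:=|\mathcal A|\le 3m-3$. (b) Let $m\ge 3$ and assume that $\mathbb K$ contains a primitive $(m-2)$-th root of unity (for instance $\mathbb K=\mathbb C$). Then the full monomial arrangement $$\mathcal A(m-2,1,3):\ xyz(x^{m-2}-y^{m-2})(y^{m-2}-z^{m-2})(x^{m-2}-z^{m-2})=0,$$ that is, the set of lines contained in this curve, is a supersolvable line arrangement all of whose modular points have multiplicity $m$, and it consists of exactly $3m-3$ lines. Hence the bound in (a) is sharp for this arrangement. -/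

import Mathlib

open scoped LinearAlgebra.Projectivization

namespace LineArrangement

variable (K : Type*) [Field K]

/-- Points of the projective plane over `K`. -/
abbrev Point := ℙ K (Fin 3 → K)

/-- Lines of the projective plane over `K`: the line with equation `a x + b y + c z = 0` is given
by its coefficient vector `(a : b : c)`, up to scaling. The incidence relation `p ∈ ℓ` is the
one Mathlib puts on the projective plane over a field, the vanishing of the dot product. -/
abbrev Line := ℙ K (Fin 3 → K)

variable {K}

/-- An intersection point of the line arrangement `A`: a point on two distinct lines of `A`. -/
def IsIntersectionPoint (A : Set (Line K)) (p : Point K) : Prop :=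
  ∃ ℓ ∈ A, ∃ ℓ' ∈ A, ℓ ≠ ℓ' ∧ p ∈ ℓ ∧ p ∈ ℓ'

/-- The multiplicity of the point `p` in `A`: the number of lines of `A` through `p`. -/
noncomputable def mult (A : Set (Line K)) (p : Point K) : ℕ :=
  {ℓ : Line K | ℓ ∈ A ∧ p ∈ ℓ}.ncard

/-- A modular point of `A`: an intersection point `p` such that, for every other intersection
point `q`, the line joining `p` and `q` belongs to `A`. -/
def IsModularPoint (A : Set (Line K)) (p : Point K) : Prop :=
  IsIntersectionPoint A p ∧
    ∀ q : Point K, IsIntersectionPoint A q → q ≠ p → ∃ ℓ ∈ A, p ∈ ℓ ∧ q ∈ ℓ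

/-- A line arrangement is supersolvable if it has a modular point. -/
def IsSupersolvable (A : Set (Line K)) : Prop :=
  ∃ p : Point K, IsModularPoint A p

/-- A supersolvable arrangement is `m`-homogeneous if all its modular points have
multiplicity `m`. -/
def IsHomogeneousSupersolvable (A : Set (Line K)) (m : ℕ) : Prop :=
  IsSupersolvable A ∧ ∀ p : Point K, IsModularPoint A p → mult A p = m

variable (K) in
/-- The full monomial arrangement `A(n,1,3)`: the lines contained in the curve
`xyz(x^n - y^n)(y^n - z^n)(x^n - z^n) = 0`. -/
def fullMonomial (n : ℕ) : Set (Line K) :=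
  {ℓ | ∀ (v : Fin 3 → K) (hv : v ≠ 0), (Projectivization.mk K v hv : Point K) ∈ ℓ →
    v 0 * v 1 * v 2 * (v 0 ^ n - v 1 ^ n) * (v 1 ^ n - v 2 ^ n) * (v 0 ^ n - v 2 ^ n) = 0}

end LineArrangement

/-! Part (a). Choose an affine chart in which the lines through the modular point `p` are the
vertical lines over the roots of a monic `Q` of degree `m`. The other lines are graphs `z_i = a_i +
b_i X`, and modularity says that any two of them meet over a root of `Q`. Such graphs are common
solutions of one differential equation `Q y' = F(x, y)`, with `F` of degree at most `m - 1` in `y`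
(`exists_polynomial_eval_linear_eq`).

Since `z_i'' = 0`, differentiating the equation shows that every `z_i` is a root of `Q F_x + F F_y -
Q' F`, whose degree in `y` is at most `2m - 3`. With more than `2m - 3` lines this polynomial
vanishes identically. Comparing degrees in `F F_y = Q' F - Q F_x` then makes `F` affine in `y`, and
specializing `x` gives a linear relation between the `a_i` and `b_i`: the lines off `p` share a
point `q`. If there are at least two of them, `q` is modular (`isModularPoint_of_common_point`), so
maximality of `m` bounds their number by `m - 1`. In all cases at most `2m - 3` lines avoid `p`.

Part (b), with `n = m - 2`. A polynomial identity along a line identifies the components of the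
curve as `x_i = 0` and `x_{i+1} = c x_{i+2}` with `c ^ n = 1`, hence `3(n + 1)` lines. The only
modular points are the coordinate vertices and, for `n = 1`, also `(1 : 1 : 1)`; all have
multiplicity `n + 2`. -/

section TangentPolynomial

open Polynomial

variable {K ι : Type*} [Field K]

/-! ### Affine lines as solutions of a polynomial differential equation -/

/-- If a bivariate polynomial `F` takes the value `Q b_i` at each linear polynomial
`z_i = a_i + b_i X`, and the `z_i` meet `z_j` above roots of `Q`, then the obstruction to `F`
taking the value `Q b_j` at `z_j` is divisible by the product of the `z_j - z_i`. -/
lemma prod_linear_sub_dvd_sub_eval (s : Finset ι) (a b : ι → K) (Q : K[X]) (F : K[X][X]) (j : ι)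
    (hb : ∀ i ∈ s, ∀ k ∈ s, i ≠ k → b i ≠ b k)
    (hj : ∀ i ∈ s, b i ≠ b j ∧ ∃ τ, Q.IsRoot τ ∧ a i + b i * τ = a j + b j * τ)
    (hF : ∀ i ∈ s, F.eval (C (a i) + C (b i) * X) = Q * C (b i)) :
    ∏ i ∈ s, ((C (a j) + C (b j) * X) - (C (a i) + C (b i) * X)) ∣
      Q * C (b j) - F.eval (C (a j) + C (b j) * X) := by
  classical
  have hj' : ∀ i, ∃ τ, i ∈ s → Q.IsRoot τ ∧ a i + b i * τ = a j + b j * τ := fun i => by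
    by_cases h : i ∈ s
    · obtain ⟨-, τ, h1⟩ := hj i h
      exact ⟨τ, fun _ => h1⟩
    · exact ⟨0, fun h' => absurd h' h⟩
  choose τ hτ using hj'
  have hdiff : ∀ i ∈ s, (C (a j) + C (b j) * X) - (C (a i) + C (b i) * X) =
      C (b j - b i) * (X - C (τ i)) := fun i hi => by
    have h : a j = a i + b i * τ i - b j * τ i := by linear_combination -(hτ i hi).2
    rw [h]
    simp only [map_add, map_sub, map_mul]
    ring
  -- Group the factors by the root over which `z_i` meets `z_j`: different groups are coprime, so
  -- each group can be treated alone.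
  rw [← Finset.prod_fiberwise_of_maps_to (t := s.image τ) (g := τ)
    fun i hi => Finset.mem_image_of_mem τ hi]
  refine Finset.prod_dvd_of_coprime ?_ ?_
  · intro t _ t' _ htt'
    refine IsCoprime.prod_left fun i hi => IsCoprime.prod_right fun k hk => ?_
    rw [Finset.mem_filter] at hi hk
    rw [hdiff i hi.1, hdiff k hk.1, hi.2, hk.2]
    have hu : ∀ i ∈ s, IsUnit (C (b j - b i)) := fun i hi =>
      isUnit_C.2 (sub_ne_zero.2 (hj i hi).1.symm).isUnit
    rw [isCoprime_mul_unit_left_left (hu i hi.1), isCoprime_mul_unit_left_right (hu k hk.1)]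
    exact isCoprime_X_sub_C_of_isUnit_sub (sub_ne_zero.2 htt').isUnit
  · intro t ht
    obtain ⟨i₀, hi₀, rfl⟩ := Finset.mem_image.1 ht
    obtain ⟨R, hR⟩ := dvd_iff_isRoot.2 (hτ i₀ hi₀).1
    set t := τ i₀
    -- All lines of the group pass through the point of `z_j` over `t`, so `R` times (`z_i` minus
    -- its height) equals `Q b_i`. Hence `G` has the distinct roots `z_i`, and its value at `z_j` is
    -- the obstruction.
    set G : K[X][X] := C R * (X - C (C (a j + b j * t))) - F with hG
    have hdvd : ∏ i ∈ s with τ i = t, (X - C (C (a i) + C (b i) * X) : K[X][X]) ∣ G := by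
      by_cases hG0 : G = 0
      · rw [hG0]; exact dvd_zero _
      have hinj : Set.InjOn (fun i => (C (a i) + C (b i) * X : K[X]))
          (({i ∈ s | τ i = t} : Finset ι) : Set ι) := by
        intro i hi k hk hik
        by_contra hne
        have hi' := (Finset.mem_filter.1 hi).1
        have hk' := (Finset.mem_filter.1 hk).1
        refine hb i hi' k hk' hne ?_
        have := congrArg (fun P => coeff P 1) hik
        simpa using this
      have := (Multiset.prod_X_sub_C_dvd_iff_le_roots hG0
        (Finset.image (fun i => (C (a i) + C (b i) * X : K[X]))
          ({i ∈ s | τ i = t} : Finset ι)).val).2 ?_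
      · have h2 := Finset.prod_image (f := fun c => (X - C c : K[X][X])) hinj
        rw [← h2]
        exact this
      · rw [Multiset.le_iff_subset (Finset.nodup _)]
        intro c hc
        rw [Finset.mem_val, Finset.mem_image] at hc
        obtain ⟨i, hi, rfl⟩ := hc
        rw [Finset.mem_filter] at hi
        rw [mem_roots hG0, IsRoot, hG, eval_sub, hF i hi.1, eval_mul, eval_C, eval_sub, eval_X,
          eval_C, hR]
        have h1 := (hτ i hi.1).2
        rw [hi.2] at h1
        rw [← h1]
        simp only [map_add, map_mul]
        ring
    have := eval_dvd (x := C (a j) + C (b j) * X) hdvd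
    rw [eval_prod] at this
    simp only [eval_sub, eval_X, eval_C] at this
    convert this using 1
    rw [hG, eval_sub, eval_mul, eval_C, eval_sub, eval_X, eval_C, hR]
    simp only [map_add, map_mul]
    ring

/-- Newton interpolation, one line at a time. The middle condition serves only the induction: it
keeps the top-degree behaviour of `F` along lines equal to that of `x ^ (m - 1) y`, which bounds the
degree of each correction. -/
lemma exists_polynomial_eval_linear_eq (s : Finset ι) (a b : ι → K) (Q : K[X]) (m : ℕ)
    (hm : 2 ≤ m) (hQ : Q.Monic) (hdeg : Q.natDegree = m)
    (H : ∀ i ∈ s, ∀ j ∈ s, i ≠ j →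
      b i ≠ b j ∧ ∃ τ, Q.IsRoot τ ∧ a i + b i * τ = a j + b j * τ) :
    ∃ F : K[X][X], F.natDegree ≤ m - 1 ∧
      (∀ l : K[X], l.natDegree ≤ 1 → (F.eval l - X ^ (m - 1) * l).natDegree ≤ m - 1) ∧
      ∀ i ∈ s, F.eval (C (a i) + C (b i) * X) = Q * C (b i) := by
  classical
  induction s using Finset.induction_on with
  | empty =>
    refine ⟨C (X ^ (m - 1)) * X, ?_, fun l _ => ?_, by simp⟩
    · exact (natDegree_C_mul_le _ _).trans (by rw [natDegree_X]; omega)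
    · simp
  | insert j s hjs ih =>
    obtain ⟨F, hF1, hF2, hF3⟩ := ih fun i hi k hk =>
      H i (Finset.mem_insert_of_mem hi) k (Finset.mem_insert_of_mem hk)
    have hj : ∀ i ∈ s, b i ≠ b j ∧ ∃ τ, Q.IsRoot τ ∧ a i + b i * τ = a j + b j * τ :=
      fun i hi => H i (Finset.mem_insert_of_mem hi) j (Finset.mem_insert_self _ _)
        (ne_of_mem_of_not_mem hi hjs)
    obtain ⟨g, hg⟩ := prod_linear_sub_dvd_sub_eval s a b Q F j
      (fun i hi k hk h =>
        (H i (Finset.mem_insert_of_mem hi) k (Finset.mem_insert_of_mem hk) h).1) hj hF3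
    have hlin : ∀ i, (C (a i) + C (b i) * X : K[X]).natDegree ≤ 1 := fun i => by
      rw [add_comm]; exact natDegree_linear_le
    set P : K[X] := ∏ i ∈ s, ((C (a j) + C (b j) * X) - (C (a i) + C (b i) * X)) with hP
    have hPdeg : P.natDegree = s.card := by
      have h1 : ∀ i ∈ s, ((C (a j) + C (b j) * X) - (C (a i) + C (b i) * X) : K[X]).natDegree
          = 1 := fun i hi => by
        have : ((C (a j) + C (b j) * X) - (C (a i) + C (b i) * X) : K[X]) =
            C (b j - b i) * X + C (a j - a i) := by
          simp only [map_sub]; ring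
        rw [this]
        exact natDegree_linear (sub_ne_zero.2 (hj i hi).1.symm)
      rw [hP, natDegree_prod _ _ fun i hi h0 => by simpa [h0] using h1 i hi,
        Finset.sum_congr rfl h1]
      simp
    have hP0 : P ≠ 0 := by
      rw [hP]
      refine Finset.prod_ne_zero_iff.2 fun i hi h0 => (hj i hi).1 ?_
      have := congrArg (fun P => coeff P 1) h0
      simp only [coeff_sub, coeff_add, coeff_C_mul, coeff_X_one, coeff_C_succ, mul_one, zero_add,
        coeff_zero] at this
      exact (sub_eq_zero.1 this).symm
    -- The terms `b_j X ^ m` cancel, `Q` being monic of degree `m`.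
    have hhdeg : (Q * C (b j) - F.eval (C (a j) + C (b j) * X)).natDegree ≤ m - 1 := by
      have h1 : Q * C (b j) - F.eval (C (a j) + C (b j) * X) =
          (Q - X ^ m) * C (b j) - C (a j) * X ^ (m - 1) -
          (F.eval (C (a j) + C (b j) * X) - X ^ (m - 1) * (C (a j) + C (b j) * X)) := by
        obtain ⟨k, rfl⟩ : ∃ k, m = k + 1 := ⟨m - 1, by omega⟩
        simp only [Nat.add_sub_cancel]
        ring
      rw [h1]
      suffices h2 : ((Q - X ^ m) * C (b j)).natDegree ≤ m - 1 from
        (natDegree_sub_le_of_le (natDegree_sub_le_of_le h2 (natDegree_C_mul_X_pow_le _ _))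
          (hF2 _ (hlin j))).trans (by simp)
      refine (natDegree_mul_C_le _ _).trans ?_
      have h2 : (Q - X ^ m).degree < Q.degree :=
        degree_sub_lt_left (by rw [degree_X_pow, degree_eq_natDegree hQ.ne_zero, hdeg]) hQ.ne_zero
          (by rw [hQ.leadingCoeff, leadingCoeff_X_pow])
      by_cases h3 : Q - X ^ m = 0
      · simp [h3]
      · have := natDegree_lt_natDegree h3 h2
        omega
    -- Once `s` has `m` or more lines, `g = 0`: the new line already satisfies the equation.
    have hgs : g = 0 ∨ g.natDegree + s.card ≤ m - 1 := by
      by_cases hg0 : g = 0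
      · exact Or.inl hg0
      · right
        rw [hg, natDegree_mul hP0 hg0, hPdeg] at hhdeg
        omega
    refine ⟨F + C g * ∏ i ∈ s, (X - C (C (a i) + C (b i) * X)), ?_, ?_, ?_⟩
    · refine natDegree_add_le_of_degree_le hF1 ?_
      rcases hgs with rfl | hgs
      · simp
      · refine (natDegree_C_mul_le _ _).trans ?_
        rw [natDegree_finsetProd_X_sub_C_eq_card]
        omega
    · intro l hl
      have : (F + C g * ∏ i ∈ s, (X - C (C (a i) + C (b i) * X))).eval l - X ^ (m - 1) * l =
          (F.eval l - X ^ (m - 1) * l) + g * ∏ i ∈ s, (l - (C (a i) + C (b i) * X)) := by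
        simp only [eval_add, eval_mul, eval_C, eval_prod, eval_sub, eval_X]
        ring
      rw [this]
      refine natDegree_add_le_of_degree_le (hF2 l hl) ?_
      rcases hgs with rfl | hgs
      · simp
      · refine natDegree_mul_le.trans (le_trans ?_ hgs)
        refine Nat.add_le_add_left ((natDegree_prod_le _ _).trans ?_) _
        refine (Finset.sum_le_card_nsmul _ _ 1 fun i _ => ?_).trans (by simp)
        exact (natDegree_sub_le_of_le hl (hlin i)).trans (by simp)
    · intro i hi
      rw [eval_add, eval_mul, eval_C, eval_prod]
      simp only [eval_sub, eval_X, eval_C]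
      rcases Finset.mem_insert.1 hi with rfl | hi
      · rw [← hP, mul_comm g, ← hg]
        ring
      · rw [Finset.prod_eq_zero hi (sub_self _), mul_zero, add_zero, hF3 i hi]

/-- The chain rule for `F(X, l(X))`, with `D` the partial derivative in the inner variable. -/
lemma exists_derivative_eval_eq (F : K[X][X]) : ∃ D : K[X][X], D.natDegree ≤ F.natDegree ∧
    ∀ l : K[X], derivative (F.eval l) =
      D.eval l + (derivative F).eval l * derivative l := by
  refine ⟨∑ i ∈ Finset.range (F.natDegree + 1), C (derivative (F.coeff i)) * X ^ i, ?_, ?_⟩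
  · refine natDegree_sum_le_of_forall_le _ _ fun i hi => ?_
    refine (natDegree_C_mul_X_pow_le _ _).trans ?_
    have := Finset.mem_range.1 hi
    omega
  · intro l
    rw [derivative_eval, sum_over_range _ (by simp), eval_eq_sum_range, derivative_sum,
      eval_finsetSum, Finset.sum_mul, ← Finset.sum_add_distrib]
    refine Finset.sum_congr rfl fun i _ => ?_
    rw [derivative_mul, derivative_pow, eval_mul, eval_C, eval_pow, eval_X, map_natCast]
    ring

/-- In characteristic zero, a finite set of non-vertical affine lines `y = a_i + b_i x` with
pairwise distinct slopes, any two of which meet above a root of a monic polynomial `Q` of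
degree `m`, has at most `2 m - 3` elements unless the lines are concurrent or parallel. -/
theorem card_le_or_collinear_of_meet_over_roots [CharZero K] (s : Finset ι) (a b : ι → K)
    (Q : K[X]) (m : ℕ) (hm : 2 ≤ m) (hQ : Q.Monic) (hdeg : Q.natDegree = m)
    (H : ∀ i ∈ s, ∀ j ∈ s, i ≠ j →
      b i ≠ b j ∧ ∃ τ, Q.IsRoot τ ∧ a i + b i * τ = a j + b j * τ) :
    s.card ≤ 2 * m - 3 ∨
      ∃ α β γ : K, (α ≠ 0 ∨ β ≠ 0) ∧ ∀ i ∈ s, α * a i + β * b i = γ := by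
  obtain ⟨F, hF1, -, hF3⟩ := exists_polynomial_eval_linear_eq s a b Q m hm hQ hdeg H
  obtain ⟨D, hD1, hD2⟩ := exists_derivative_eval_eq F
  by_cases hcard : s.card ≤ 2 * m - 3
  · exact Or.inl hcard
  right
  -- Differentiate `F(X, z_i) = Q b_i`, multiply by `Q` and replace `Q b_i` by `F(X, z_i)`. The
  -- middle term has degree at most `(m - 1) + (m - 2)`; the other two, at most `m - 1`, fit because
  -- `m ≥ 2`.
  have hE : C Q * D + F * derivative F - C (derivative Q) * F = 0 := by
    have hinj : Function.Injective
        (fun i : s => (C (a i) + C (b i) * X : K[X])) := by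
      intro i k hik
      by_contra hne
      refine (H i i.2 k k.2 fun h => hne (Subtype.ext h)).1 ?_
      have := congrArg (fun P => coeff P 1) hik
      simpa using this
    refine eq_zero_of_natDegree_lt_card_of_eval_eq_zero _ hinj (fun i => ?_) ?_
    · have h1 := hD2 (C (a i) + C (b i) * X)
      rw [hF3 i i.2] at h1
      simp only [derivative_mul, derivative_add, derivative_C, derivative_X, mul_zero, mul_one,
        zero_mul, add_zero, zero_add] at h1
      simp only [eval_sub, eval_add, eval_mul, eval_C, hF3 i i.2]
      linear_combination (-Q) * h1
    · rw [Fintype.card_coe]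
      have h1 : (derivative F).natDegree ≤ m - 2 := (natDegree_derivative_le F).trans (by omega)
      have h2 : (C Q * D).natDegree ≤ 2 * m - 3 := (natDegree_C_mul_le _ _).trans (by omega)
      have h3 : (F * derivative F).natDegree ≤ 2 * m - 3 := natDegree_mul_le.trans (by omega)
      have h4 : (C (derivative Q) * F).natDegree ≤ 2 * m - 3 :=
        (natDegree_C_mul_le _ _).trans (by omega)
      exact ((natDegree_sub_le_of_le (natDegree_add_le_of_degree_le h2 h3) h4).trans
        (max_self _).le).trans_lt (by omega)
  -- In characteristic zero `F F_y` has degree `2d - 1` when `d = deg F > 1`, whereas the other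
  -- terms have degree at most `d`.
  have hF4 : F.natDegree ≤ 1 := by
    by_contra hlt
    have hF0 : F ≠ 0 := by rintro rfl; simp at hlt
    have h1 : (derivative F).natDegree = F.natDegree - 1 := natDegree_derivative F
    have h2 : derivative F ≠ 0 := by
      intro h0
      rw [h0, natDegree_zero] at h1
      omega
    have h3 := natDegree_mul hF0 h2
    have h4 : F * derivative F = C (derivative Q) * F - C Q * D := by
      linear_combination hE
    have h5 : (F * derivative F).natDegree ≤ F.natDegree := by
      rw [h4]
      exact (natDegree_sub_le_of_le (natDegree_C_mul_le _ _)
        ((natDegree_C_mul_le _ _).trans hD1)).trans (max_self _).le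
    omega
  obtain ⟨p, q, hpq⟩ := exists_eq_X_add_C_of_natDegree_le_one hF4
  obtain ⟨t, ht⟩ : ∃ t, Q.eval t ≠ 0 := by
    by_contra! h
    exact hQ.ne_zero (funext fun t => by simpa using h t)
  -- This is `p(t) (a_i + b_i t) + q(t) = Q(t) b_i` rearranged; `Q(t) ≠ 0` makes it nontrivial.
  refine ⟨-p.eval t, Q.eval t - p.eval t * t, q.eval t, ?_, fun i hi => ?_⟩
  · by_contra! h
    have h1 : p.eval t = 0 := neg_eq_zero.1 h.1
    rw [h1, zero_mul, sub_zero] at h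
    exact ht h.2
  · have h1 := congrArg (eval t) (hF3 i hi)
    rw [hpq] at h1
    simp only [eval_add, eval_mul, eval_C, eval_X] at h1
    linear_combination -h1

end TangentPolynomial

namespace LineArrangement

open Matrix Polynomial

variable {K : Type*} [Field K]

/-! ### Incidence and normalized equations of lines -/

lemma mk_mem_mk_iff {v w : Fin 3 → K} (hv : v ≠ 0) (hw : w ≠ 0) :
    (Projectivization.mk K v hv : Point K) ∈ (Projectivization.mk K w hw : Line K) ↔
      v ⬝ᵥ w = 0 :=
  Iff.rfl

lemma mem_iff_rep_dotProduct_rep {p : Point K} {ℓ : Line K} :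
    p ∈ ℓ ↔ p.rep ⬝ᵥ ℓ.rep = 0 := by
  conv_lhs => rw [← p.mk_rep, ← ℓ.mk_rep]
  exact Iff.rfl

lemma mk_mem_iff_dotProduct_rep {v : Fin 3 → K} (hv : v ≠ 0) {ℓ : Line K} :
    (Projectivization.mk K v hv : Point K) ∈ ℓ ↔ v ⬝ᵥ ℓ.rep = 0 := by
  conv_lhs => rw [← ℓ.mk_rep]
  exact Iff.rfl

lemma eq_of_mem_of_mem {p q : Point K} {ℓ ℓ' : Line K} (hpq : p ≠ q) (h1 : p ∈ ℓ) (h2 : q ∈ ℓ)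
    (h3 : p ∈ ℓ') (h4 : q ∈ ℓ') : ℓ = ℓ' :=
  (Configuration.Nondegenerate.eq_or_eq h1 h2 h3 h4).resolve_left hpq

lemma exists_point_mem_mem {ℓ ℓ' : Line K} (h : ℓ ≠ ℓ') : ∃ q : Point K, q ∈ ℓ ∧ q ∈ ℓ' := by
  classical
  exact ⟨Projectivization.cross ℓ ℓ', Projectivization.cross_orthogonal_left h,
    Projectivization.cross_orthogonal_right h⟩

lemma mem_mk_iff_rep_dotProduct {p : Point K} {w : Fin 3 → K} (hw : w ≠ 0) :
    p ∈ (Projectivization.mk K w hw : Line K) ↔ p.rep ⬝ᵥ w = 0 := by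
  conv_lhs => rw [← p.mk_rep]
  exact Iff.rfl

/-- The representative of a line that takes the value `1` at the vector `P`. -/
noncomputable def normalizedRep (P : Fin 3 → K) (ℓ : Line K) : Fin 3 → K :=
  (P ⬝ᵥ ℓ.rep)⁻¹ • ℓ.rep

lemma dotProduct_normalizedRep_self {P : Fin 3 → K} {ℓ : Line K} (h : P ⬝ᵥ ℓ.rep ≠ 0) :
    P ⬝ᵥ normalizedRep P ℓ = 1 := by
  rw [normalizedRep, dotProduct_smul, smul_eq_mul, inv_mul_cancel₀ h]

lemma dotProduct_normalizedRep_eq_zero_iff {P : Fin 3 → K} {ℓ : Line K}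
    (h : P ⬝ᵥ ℓ.rep ≠ 0) (x : Fin 3 → K) :
    x ⬝ᵥ normalizedRep P ℓ = 0 ↔ x ⬝ᵥ ℓ.rep = 0 := by
  rw [normalizedRep, dotProduct_smul, smul_eq_mul, mul_eq_zero, inv_eq_zero]
  exact or_iff_right h

lemma normalizedRep_ne {P : Fin 3 → K} {ℓ ℓ' : Line K} (h : P ⬝ᵥ ℓ.rep ≠ 0)
    (hne : ℓ ≠ ℓ') : normalizedRep P ℓ ≠ normalizedRep P ℓ' := by
  intro heq
  refine hne ?_
  rw [← ℓ.mk_rep, ← ℓ'.mk_rep, Projectivization.mk_eq_mk_iff']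
  refine ⟨(P ⬝ᵥ ℓ.rep) * (P ⬝ᵥ ℓ'.rep)⁻¹, ?_⟩
  rw [mul_smul, ← normalizedRep, ← heq, normalizedRep, smul_smul, mul_inv_cancel₀ h, one_smul]

lemma exists_forall_dotProduct_rep_ne_zero [Infinite K] (T : Finset (Line K)) :
    ∃ v : Fin 3 → K, ∀ ℓ ∈ T, v ⬝ᵥ ℓ.rep ≠ 0 := by
  obtain ⟨f, hf⟩ := Module.exists_dual_forall_apply_ne_zero (K := K)
    (fun ℓ : T => (ℓ : Line K).rep) fun ℓ => ℓ.1.rep_nonzero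
  refine ⟨(dotProductEquiv K (Fin 3)).symm f, fun ℓ hℓ => ?_⟩
  have := hf ⟨ℓ, hℓ⟩
  rwa [← (dotProductEquiv K (Fin 3)).apply_symm_apply f] at this

/-- If two distinct lines `ℓ, ℓ'` avoiding `p` meet on a line `L` through `p`, then the difference
of their normalized representatives is a nonzero multiple of the one of `L`. -/
lemma exists_normalizedRep_sub_eq_smul {p q : Point K} {ℓ ℓ' L : Line K} (hne : ℓ ≠ ℓ')
    (hp : p ∉ ℓ) (hp' : p ∉ ℓ') (hq : q ∈ ℓ) (hq' : q ∈ ℓ') (hpL : p ∈ L) (hqL : q ∈ L) :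
    ∃ c : K, c ≠ 0 ∧ normalizedRep p.rep ℓ - normalizedRep p.rep ℓ' = c • L.rep := by
  have hpq : p ≠ q := fun h => hp (h ▸ hq)
  rw [mem_iff_rep_dotProduct_rep] at hp hp' hq hq'
  have hδ : normalizedRep p.rep ℓ - normalizedRep p.rep ℓ' ≠ 0 :=
    sub_ne_zero.2 (normalizedRep_ne hp hne)
  have h : Projectivization.mk K _ hδ = Projectivization.mk K L.rep L.rep_nonzero := by
    rw [L.mk_rep]
    refine eq_of_mem_of_mem hpq ?_ ?_ hpL hqL
    · rw [mem_mk_iff_rep_dotProduct, dotProduct_sub, dotProduct_normalizedRep_self hp,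
        dotProduct_normalizedRep_self hp', sub_self]
    · rw [mem_mk_iff_rep_dotProduct, dotProduct_sub,
        (dotProduct_normalizedRep_eq_zero_iff hp _).2 hq,
        (dotProduct_normalizedRep_eq_zero_iff hp' _).2 hq', sub_self]
  obtain ⟨c, hc⟩ := (Projectivization.mk_eq_mk_iff' K _ _ _ _).1 h
  refine ⟨c, ?_, hc.symm⟩
  rintro rfl
  exact hδ (by rw [← hc, zero_smul])

lemma exists_crossProduct_dotProduct_ne_zero {P v : Fin 3 → K} (h : crossProduct v P ≠ 0) :
    ∃ u, u ⬝ᵥ crossProduct v P ≠ 0 := by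
  by_contra! h'
  refine h (dotProduct_eq_zero_iff.1 fun u => ?_)
  rw [dotProduct_comm, h']

/-! ### The bound for supersolvable arrangements -/

/-- The lines avoiding a modular point of multiplicity `m` are at most `2 m - 3` in number, or
they have a common point. -/
theorem ncard_le_or_exists_common_point [CharZero K] {A : Set (Line K)} (hA : A.Finite)
    {p : Point K} (hp : IsModularPoint A p) {m : ℕ} (hm : mult A p = m) (hm2 : 2 ≤ m) :
    {ℓ | ℓ ∈ A ∧ p ∉ ℓ}.ncard ≤ 2 * m - 3 ∨
      ∃ q : Point K, q ≠ p ∧ ∀ ℓ ∈ A, p ∉ ℓ → q ∈ ℓ := by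
  have hTfin : {ℓ | ℓ ∈ A ∧ p ∈ ℓ}.Finite := hA.subset fun ℓ h => h.1
  have hSfin : {ℓ | ℓ ∈ A ∧ p ∉ ℓ}.Finite := hA.subset fun ℓ h => h.1
  -- The chart is `(τ, y) ↦ u + τ v - y P` with `P = p.rep`. Since `v` avoids every line `L` through
  -- `p`, each `L` is a vertical line at the finite abscissa `-(u · L) / (v · L)`.
  obtain ⟨v, hv⟩ := exists_forall_dotProduct_rep_ne_zero hTfin.toFinset
  have hv : ∀ L ∈ A, p ∈ L → v ⬝ᵥ L.rep ≠ 0 := fun L hL hpL =>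
    hv L (hTfin.mem_toFinset.2 ⟨hL, hpL⟩)
  obtain ⟨L₀, hL₀, -, -, -, hpL₀, -⟩ := hp.1
  have hvP : crossProduct v p.rep ≠ 0 := by
    intro h0
    have hv0 : v ≠ 0 := by
      rintro rfl
      exact hv L₀ hL₀ hpL₀ (zero_dotProduct _)
    refine hv L₀ hL₀ hpL₀ ?_
    rw [← mk_mem_iff_dotProduct_rep hv0,
      (Projectivization.mk_eq_mk_iff_crossProduct_eq_zero hv0 p.rep_nonzero).2 h0, p.mk_rep]
    exact hpL₀
  obtain ⟨u, hu⟩ := exists_crossProduct_dotProduct_ne_zero hvP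
  set Q : K[X] := ∏ L ∈ hTfin.toFinset, (X - C (-(u ⬝ᵥ L.rep) / (v ⬝ᵥ L.rep))) with hQ
  have hQdeg : Q.natDegree = m := by
    rw [hQ, natDegree_finsetProd_X_sub_C_eq_card, ← hm, mult, Set.ncard_eq_toFinset_card _ hTfin]
  have key := card_le_or_collinear_of_meet_over_roots hSfin.toFinset
    (fun ℓ => u ⬝ᵥ normalizedRep p.rep ℓ) (fun ℓ => v ⬝ᵥ normalizedRep p.rep ℓ) Q m hm2
    (monic_prod_X_sub_C _ _) hQdeg ?_
  · refine key.imp (fun h => ?_) ?_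
    · rwa [Set.ncard_eq_toFinset_card _ hSfin]
    · rintro ⟨α, β, γ, hαβ, h⟩
      -- Pairing with `v × P` isolates `α`; pairing with a line through `p` then isolates `β`.
      have hq : ∀ c : K, α • u + β • v - γ • p.rep ≠ c • p.rep := by
        intro c hc
        have h1 := congrArg (fun x => x ⬝ᵥ crossProduct v p.rep) hc
        have hL₀P := mem_iff_rep_dotProduct_rep.1 hpL₀
        simp only [sub_dotProduct, add_dotProduct, smul_dotProduct, smul_eq_mul, dot_self_cross,
          dot_cross_self, mul_zero, add_zero, sub_zero] at h1
        have hα := (mul_eq_zero.1 h1).resolve_right hu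
        have h2 := congrArg (fun x => x ⬝ᵥ L₀.rep) hc
        simp only [hα, sub_dotProduct, add_dotProduct, smul_dotProduct, hL₀P, smul_eq_mul,
          mul_zero, zero_mul, sub_zero, zero_add] at h2
        have hβ := (mul_eq_zero.1 h2).resolve_right (hv L₀ hL₀ hpL₀)
        exact hαβ.elim (fun h => h hα) fun h => h hβ
      have hq0 : α • u + β • v - γ • p.rep ≠ 0 := by simpa using hq 0
      refine ⟨Projectivization.mk K _ hq0, fun heq => ?_, fun ℓ hℓ hpℓ => ?_⟩
      · conv_rhs at heq => rw [← p.mk_rep]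
        obtain ⟨c, hc⟩ := (Projectivization.mk_eq_mk_iff' K _ _ _ _).1 heq
        exact hq c hc.symm
      · have h1 := h ℓ (hSfin.mem_toFinset.2 ⟨hℓ, hpℓ⟩)
        rw [mem_iff_rep_dotProduct_rep] at hpℓ
        rw [mk_mem_iff_dotProduct_rep, ← dotProduct_normalizedRep_eq_zero_iff hpℓ,
          sub_dotProduct, add_dotProduct, smul_dotProduct, smul_dotProduct, smul_dotProduct,
          dotProduct_normalizedRep_self hpℓ]
        simpa [sub_eq_zero] using h1
  · intro ℓ hℓ ℓ' hℓ' hne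
    obtain ⟨hℓA, hpℓ⟩ := hSfin.mem_toFinset.1 hℓ
    obtain ⟨hℓA', hpℓ'⟩ := hSfin.mem_toFinset.1 hℓ'
    obtain ⟨q, hq, hq'⟩ := exists_point_mem_mem hne
    have hqp : q ≠ p := fun h => hpℓ (h ▸ hq)
    obtain ⟨L, hL, hpL, hqL⟩ := hp.2 q ⟨ℓ, hℓA, ℓ', hℓA', hne, hq, hq'⟩ hqp
    obtain ⟨c, hc, hδ⟩ := exists_normalizedRep_sub_eq_smul hne hpℓ hpℓ' hq hq' hpL hqL
    have hb := congrArg (fun x => v ⬝ᵥ x) hδ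
    have ha := congrArg (fun x => u ⬝ᵥ x) hδ
    simp only [dotProduct_sub, dotProduct_smul, smul_eq_mul] at ha hb
    have hvL := hv L hL hpL
    refine ⟨fun h => ?_, -(u ⬝ᵥ L.rep) / (v ⬝ᵥ L.rep), ?_, ?_⟩
    · rw [h, sub_self] at hb
      exact mul_ne_zero hc hvL hb.symm
    · rw [IsRoot, hQ, eval_prod]
      exact Finset.prod_eq_zero (hTfin.mem_toFinset.2 ⟨hL, hpL⟩) (by simp)
    · have h1 : -(u ⬝ᵥ L.rep) / (v ⬝ᵥ L.rep) * (v ⬝ᵥ L.rep) = -(u ⬝ᵥ L.rep) :=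
        div_mul_cancel₀ _ hvL
      linear_combination ha + (-(u ⬝ᵥ L.rep) / (v ⬝ᵥ L.rep)) * hb + c * h1

/-- A point common to at least two lines avoiding the modular point `p`, and to all such lines,
is modular, with multiplicity one more than the number of such lines. -/
lemma isModularPoint_of_common_point {A : Set (Line K)} (hA : A.Finite) {p q : Point K}
    (hp : IsModularPoint A p) (hqp : q ≠ p) (hq : ∀ ℓ ∈ A, p ∉ ℓ → q ∈ ℓ)
    (hcard : 1 < {ℓ | ℓ ∈ A ∧ p ∉ ℓ}.ncard) :
    IsModularPoint A q ∧ mult A q = {ℓ | ℓ ∈ A ∧ p ∉ ℓ}.ncard + 1 := by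
  have hSfin : {ℓ | ℓ ∈ A ∧ p ∉ ℓ}.Finite := hA.subset fun ℓ h => h.1
  obtain ⟨ℓ, ℓ', hℓ, hℓ', hne⟩ := (Set.one_lt_ncard_iff hSfin).1 hcard
  have hqI : IsIntersectionPoint A q :=
    ⟨ℓ, hℓ.1, ℓ', hℓ'.1, hne, hq ℓ hℓ.1 hℓ.2, hq ℓ' hℓ'.1 hℓ'.2⟩
  obtain ⟨L, hL, hpL, hqL⟩ := hp.2 q hqI hqp
  refine ⟨⟨hqI, fun r hr hrq => ?_⟩, ?_⟩
  · by_cases hrp : r = p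
    · exact ⟨L, hL, hqL, hrp ▸ hpL⟩
    obtain ⟨ℓ₁, h1, ℓ₂, h2, hne, hr1, hr2⟩ := hr
    by_cases hp1 : p ∈ ℓ₁
    · have hp2 : p ∉ ℓ₂ := fun hp2 => hne (eq_of_mem_of_mem hrp hr1 hp1 hr2 hp2)
      exact ⟨ℓ₂, h2, hq ℓ₂ h2 hp2, hr2⟩
    · exact ⟨ℓ₁, h1, hq ℓ₁ h1 hp1, hr1⟩
  · rw [mult, ← Set.ncard_insert_of_notMem (a := L) (fun h => h.2 hpL) hSfin]
    congr 1
    ext ℓ₁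
    simp only [Set.mem_ofPred_eq, Set.mem_insert_iff]
    constructor
    · rintro ⟨h1, h2⟩
      by_cases hp1 : p ∈ ℓ₁
      · exact Or.inl (eq_of_mem_of_mem hqp h2 hp1 hqL hpL)
      · exact Or.inr ⟨h1, hp1⟩
    · rintro (rfl | ⟨h1, h2⟩)
      · exact ⟨hL, hqL⟩
      · exact ⟨h1, hq ℓ₁ h1 h2⟩

/-- An arrangement with a modular point whose multiplicity `m` is maximal among the modular points
has at most `3 m - 3` lines. -/
theorem ncard_le_of_isModularPoint [CharZero K] {A : Set (Line K)} (hA : A.Finite)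
    {p : Point K} {m : ℕ} (hm2 : 2 ≤ m) (hp : IsModularPoint A p) (hm : mult A p = m)
    (hmax : ∀ q : Point K, IsModularPoint A q → mult A q ≤ m) : A.ncard ≤ 3 * m - 3 := by
  have hsum : {ℓ | ℓ ∈ A ∧ p ∉ ℓ}.ncard + {ℓ | ℓ ∈ A ∧ p ∈ ℓ}.ncard = A.ncard := by
    rw [← Set.ncard_sdiff_add_ncard_of_subset (s := {ℓ | ℓ ∈ A ∧ p ∈ ℓ}) (fun ℓ h => h.1) hA]
    congr 2
    ext ℓ
    simp only [Set.mem_ofPred_eq, Set.mem_sdiff, not_and]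
    exact ⟨fun h => ⟨h.1, fun _ => h.2⟩, fun h => ⟨h.1, h.2 h.1⟩⟩
  rw [← mult, hm] at hsum
  rcases ncard_le_or_exists_common_point hA hp hm hm2 with h | ⟨q, hqp, hq⟩
  · omega
  -- With at most one line off `p`, the total is at most `m + 1 ≤ 3m - 3`, as `m ≥ 2`.
  · by_cases hcard : 1 < {ℓ | ℓ ∈ A ∧ p ∉ ℓ}.ncard
    · obtain ⟨h1, h2⟩ := isModularPoint_of_common_point hA hp hqp hq hcard
      have := hmax q h1
      omega
    · omega

/-! ### The lines of the full monomial arrangement -/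

/-- Coefficients of the lines of the full monomial arrangements: `x_i = 0` for `o = none`, and
`x_{i+1} = c x_{i+2}` for `o = some c`, the indices being taken modulo `3`. -/
def monomialVec : Fin 3 → Option K → Fin 3 → K
  | 0, none => ![1, 0, 0]
  | 1, none => ![0, 1, 0]
  | 2, none => ![0, 0, 1]
  | 0, some c => ![0, 1, -c]
  | 1, some c => ![-c, 0, 1]
  | 2, some c => ![1, -c, 0]

lemma monomialVec_ne_zero (i : Fin 3) (o : Option K) : monomialVec i o ≠ 0 := by
  intro h
  have h0 := congrFun h 0
  have h1 := congrFun h 1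
  have h2 := congrFun h 2
  fin_cases i <;> cases o <;> simp [monomialVec] at h0 h1 h2

/-- The line `x_i = 0` or `x_{i+1} = c x_{i+2}`. -/
def monomialLine (i : Fin 3) (o : Option K) : Line K :=
  Projectivization.mk K (monomialVec i o) (monomialVec_ne_zero i o)

lemma mk_mem_monomialLine_none {v : Fin 3 → K} (hv : v ≠ 0) (i : Fin 3) :
    (Projectivization.mk K v hv : Point K) ∈ monomialLine i none ↔ v i = 0 := by
  rw [monomialLine, mk_mem_mk_iff]
  fin_cases i <;> simp [monomialVec, dotProduct, Fin.sum_univ_three]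

lemma mk_mem_monomialLine_some {v : Fin 3 → K} (hv : v ≠ 0) (i : Fin 3) (c : K) :
    (Projectivization.mk K v hv : Point K) ∈ monomialLine i (some c) ↔
      v (i + 1) = c * v (i + 2) := by
  rw [monomialLine, mk_mem_mk_iff, ← sub_eq_zero (a := v (i + 1))]
  fin_cases i <;> simp [monomialVec, dotProduct, Fin.sum_univ_three, sub_eq_add_neg, mul_comm c,
    add_comm]

/-- The parameter `some 0` is excluded because it gives the line `x_{i+1} = 0` a second time. -/
lemma monomialLine_injOn :
    Set.InjOn (fun x : Fin 3 × Option K => monomialLine x.1 x.2) {x | x.2 ≠ some 0} := by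
  rintro ⟨i, o⟩ ho ⟨j, o'⟩ ho' h
  obtain ⟨a, ha⟩ := (Projectivization.mk_eq_mk_iff' K _ _ _ _).1 h
  have h0 := congrFun ha 0
  have h1 := congrFun ha 1
  have h2 := congrFun ha 2
  fin_cases i <;> fin_cases j <;> cases o <;> cases o' <;>
    simp_all [monomialVec, Set.mem_ofPred_eq]

/-- Restricted to a parametrized line, the equation of the curve is a polynomial in one variable
vanishing on the infinite field `K`, hence zero; so one of its factors vanishes identically on the
line. -/
lemma exists_eq_zero_of_forall_mem_curve [Infinite K] {n : ℕ} (hn : n ≠ 0) {w : Fin 3 → K}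
    (hw : w ≠ 0) (h : Projectivization.mk K w hw ∈ fullMonomial K n) :
    ∃ i, w i = 0 ∧ (w (i + 1) = 0 ∨ w (i + 2) = 0 ∨ w (i + 1) ^ n = (-w (i + 2)) ^ n) := by
  have hcurve : ∀ v : Fin 3 → K, v ≠ 0 → v 0 * w 0 + v 1 * w 1 + v 2 * w 2 = 0 →
      v 0 * v 1 * v 2 * (v 0 ^ n - v 1 ^ n) * (v 1 ^ n - v 2 ^ n) * (v 0 ^ n - v 2 ^ n) = 0 :=
    fun v hv hvw => h v hv (by rwa [mk_mem_mk_iff, dotProduct, Fin.sum_univ_three])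
  have hX : ∀ c : K, (C c - X ^ n : K[X]) ≠ 0 := fun c => by
    rw [← neg_ne_zero, neg_sub]
    exact (monic_X_pow_sub_C c hn).ne_zero
  by_cases h2 : w 2 = 0
  · refine ⟨2, h2, ?_⟩
    change w 0 = 0 ∨ w 1 = 0 ∨ w 0 ^ n = (-w 1) ^ n
    by_contra! hne
    obtain ⟨h0, h1, h01⟩ := hne
    have h01' : w 1 ^ n - (-w 0) ^ n ≠ 0 := by
      intro h'
      refine h01 ?_
      rw [neg_pow, sub_eq_zero.1 h', neg_pow (w 0), ← mul_assoc, ← mul_pow]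
      simp
    have hP : (X * (C ((-w 0) ^ n) - X ^ n) * (C (w 1 ^ n) - X ^ n) : K[X]) = 0 := by
      refine Polynomial.funext fun t => ?_
      have := hcurve ![w 1, -w 0, t] (fun h' => h1 (congrFun h' 0))
        (by simp [h2, mul_comm])
      simp only [Matrix.cons_val_zero, Matrix.cons_val_one, Matrix.cons_val] at this
      have h3 : (w 1 * -w 0 * (w 1 ^ n - (-w 0) ^ n)) *
          (t * ((-w 0) ^ n - t ^ n) * (w 1 ^ n - t ^ n)) = 0 := by
        linear_combination this
      simpa using (mul_eq_zero.1 h3).resolve_left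
        (mul_ne_zero (mul_ne_zero h1 (neg_ne_zero.2 h0)) h01')
    exact mul_ne_zero (mul_ne_zero X_ne_zero (hX _)) (hX _) hP
  · set r := -w 0 / w 2 with hr
    set s := -w 1 / w 2 with hs
    have h0 : w 0 = -(r * w 2) := by rw [hr]; field_simp
    have h1 : w 1 = -(s * w 2) := by rw [hs]; field_simp
    have hP : (X * (C r + C s * X) * (C 1 - X ^ n) * (X ^ n - (C r + C s * X) ^ n) *
        (1 - (C r + C s * X) ^ n) : K[X]) = 0 := by
      refine Polynomial.funext fun t => ?_
      have := hcurve ![1, t, r + s * t] (fun h' => one_ne_zero (congrFun h' 0))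
        (by simp [h0, h1]; ring)
      simpa using this
    simp only [mul_eq_zero, X_ne_zero, hX, false_or, or_false] at hP
    rcases hP with (hP | hP) | hP
    · have h3 : r = 0 := by simpa using congrArg (eval 0) hP
      have h4 : s = 0 := by simpa [h3] using congrArg (eval 1) hP
      exact ⟨0, by rw [h0, h3]; simp, Or.inl (by change w 1 = 0; rw [h1, h4]; simp)⟩
    · have h3 : r = 0 := by simpa [hn] using congrArg (eval 0) hP
      have h4 : s ^ n = 1 := by
        have := congrArg (eval 1) hP
        simp only [h3, eval_sub, eval_pow, eval_X, eval_add, eval_C, eval_mul, eval_zero] at this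
        exact (sub_eq_zero.1 (by simpa using this)).symm
      refine ⟨0, by rw [h0, h3]; simp, Or.inr (Or.inr ?_)⟩
      change w 1 ^ n = (-w 2) ^ n
      rw [h1, ← mul_neg, mul_pow, h4, one_mul]
    · have h3 : s = 0 := by
        by_contra h3
        have := congrArg (eval (-r / s)) hP
        simp [hn, mul_div_cancel₀ _ h3] at this
      have h4 : r ^ n = 1 := by
        have := congrArg (eval 0) hP
        exact (sub_eq_zero.1 (by simpa [h3] using this)).symm
      refine ⟨1, by rw [h1, h3]; simp, Or.inr (Or.inr ?_)⟩
      change w 2 ^ n = (-w 0) ^ n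
      rw [h0, neg_neg, mul_pow, h4, one_mul]

lemma mem_fullMonomial_iff [Infinite K] {n : ℕ} (hn : n ≠ 0) {ℓ : Line K} :
    ℓ ∈ fullMonomial K n ↔
      ∃ i, ℓ = monomialLine i none ∨ ∃ c : K, c ^ n = 1 ∧ ℓ = monomialLine i (some c) := by
  constructor
  · intro h
    induction ℓ using Projectivization.ind with | h w hw =>
    have hnone : ∀ i, w i ≠ 0 → w (i + 1) = 0 → w (i + 2) = 0 →
        Projectivization.mk K w hw = monomialLine i none := by
      intro i h0 h1 h2
      refine (Projectivization.mk_eq_mk_iff' K _ _ _ _).2 ⟨w i, funext fun j => ?_⟩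
      fin_cases i <;> fin_cases j <;> simp_all [monomialVec]
    obtain ⟨i, h0, h12⟩ := exists_eq_zero_of_forall_mem_curve hn hw h
    by_cases h1 : w (i + 1) = 0
    · refine ⟨i + 2, Or.inl (hnone _ (fun h2 => hw (funext fun j => ?_)) ?_ ?_)⟩
      · fin_cases i <;> fin_cases j <;> simp_all
      · rw [add_assoc]; simpa using h0
      · rw [add_assoc]; simpa using h1
    by_cases h2 : w (i + 2) = 0
    · refine ⟨i + 1, Or.inl (hnone _ h1 ?_ ?_)⟩
      · rw [add_assoc]; simpa using h2
      · rw [add_assoc]; simpa using h0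
    have h3 := (h12.resolve_left h1).resolve_left h2
    refine ⟨i, Or.inr ⟨-w (i + 2) / w (i + 1), ?_, ?_⟩⟩
    · rw [div_pow, ← h3, div_self (pow_ne_zero _ h1)]
    · refine (Projectivization.mk_eq_mk_iff' K _ _ _ _).2 ⟨w (i + 1), funext fun j => ?_⟩
      fin_cases i <;> fin_cases j <;> simp_all [monomialVec] <;> field_simp
  · rintro ⟨i, rfl | ⟨c, hc, rfl⟩⟩ v hv hmem
    · rw [mk_mem_monomialLine_none] at hmem
      fin_cases i <;> simp_all
    · rw [mk_mem_monomialLine_some] at hmem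
      have h : v (i + 1) ^ n = v (i + 2) ^ n := by rw [hmem, mul_pow, hc, one_mul]
      fin_cases i <;> simp_all

/-! ### Counting lines and multiplicities -/

/-- The parameters `(i, o)` of the lines of the full monomial arrangement. -/
noncomputable def monomialIndex (K : Type*) [Field K] (n : ℕ) : Finset (Fin 3 × Option K) :=
  Finset.univ ×ˢ Finset.insertNone (nthRootsFinset n (1 : K))

lemma monomialLine_injOn_monomialIndex {n : ℕ} (hn : n ≠ 0) :
    Set.InjOn (fun x : Fin 3 × Option K => monomialLine x.1 x.2) (monomialIndex K n) := by
  refine monomialLine_injOn.mono ?_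
  rintro ⟨i, o⟩ h (rfl : o = some 0)
  rw [Finset.mem_coe, monomialIndex, Finset.mem_product, Finset.mem_insertNone] at h
  have := (mem_nthRootsFinset (Nat.pos_of_ne_zero hn) _).1 (h.2 0 rfl)
  simp [hn] at this

lemma fullMonomial_eq_image [Infinite K] {n : ℕ} (hn : n ≠ 0) :
    fullMonomial K n =
      (fun x : Fin 3 × Option K => monomialLine x.1 x.2) '' monomialIndex K n := by
  ext ℓ
  rw [mem_fullMonomial_iff hn]
  constructor
  · rintro ⟨i, rfl | ⟨c, hc, rfl⟩⟩
    · exact ⟨(i, none), by simp [monomialIndex], rfl⟩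
    · exact ⟨(i, some c), by
        simpa [monomialIndex, mem_nthRootsFinset (Nat.pos_of_ne_zero hn)] using hc, rfl⟩
  · rintro ⟨⟨i, _ | c⟩, h, rfl⟩
    · exact ⟨i, Or.inl rfl⟩
    · refine ⟨i, Or.inr ⟨c, ?_, rfl⟩⟩
      simpa [monomialIndex, mem_nthRootsFinset (Nat.pos_of_ne_zero hn)] using h

lemma finite_fullMonomial [Infinite K] {n : ℕ} (hn : n ≠ 0) : (fullMonomial K n).Finite := by
  rw [fullMonomial_eq_image hn]
  exact (Finset.finite_toSet _).image _

lemma ncard_fullMonomial [Infinite K] {n : ℕ} (hn : n ≠ 0)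
    (hcard : (nthRootsFinset n (1 : K)).card = n) : (fullMonomial K n).ncard = 3 * (n + 1) := by
  rw [fullMonomial_eq_image hn, (monomialLine_injOn_monomialIndex hn).ncard_image,
    Set.ncard_coe_finset, monomialIndex, Finset.card_product, Finset.card_insertNone, hcard]
  simp

open Classical in
lemma mult_fullMonomial [Infinite K] {n : ℕ} (hn : n ≠ 0) (p : Point K) :
    mult (fullMonomial K n) p =
      ∑ i : Fin 3, ((if p ∈ (monomialLine i none : Line K) then 1 else 0) +
        ((nthRootsFinset n (1 : K)).filter
          fun c => p ∈ (monomialLine i (some c) : Line K)).card) := by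
  have h : {ℓ | ℓ ∈ fullMonomial K n ∧ p ∈ ℓ} =
      (fun x : Fin 3 × Option K => monomialLine x.1 x.2) ''
        ((monomialIndex K n).filter fun x => p ∈ (monomialLine x.1 x.2 : Line K)) := by
    rw [fullMonomial_eq_image hn]
    ext ℓ
    simp only [Set.mem_ofPred_eq, Set.mem_image, Finset.coe_filter, Finset.mem_coe]
    constructor
    · rintro ⟨⟨x, hx, rfl⟩, hp⟩
      exact ⟨x, ⟨hx, hp⟩, rfl⟩
    · rintro ⟨x, ⟨hx, hp⟩, rfl⟩
      exact ⟨⟨x, hx, rfl⟩, hp⟩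
  rw [mult, h, ((monomialLine_injOn_monomialIndex hn).mono
    (Finset.coe_subset.2 (Finset.filter_subset _ _))).ncard_image,
    Set.ncard_coe_finset, Finset.card_filter, monomialIndex, Finset.sum_product]
  refine Finset.sum_congr rfl fun i _ => ?_
  rw [Finset.sum_insertNone, Finset.card_filter]

lemma mult_fullMonomial_of_vertex [Infinite K] {n : ℕ} (hn : n ≠ 0)
    (hcard : (nthRootsFinset n (1 : K)).card = n) {v : Fin 3 → K} (hv : v ≠ 0) {i : Fin 3}
    (h1 : v (i + 1) = 0) (h2 : v (i + 2) = 0) :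
    mult (fullMonomial K n) (Projectivization.mk K v hv) = n + 2 := by
  classical
  have h0 : v i ≠ 0 := by
    intro h0
    refine hv (funext fun j => ?_)
    fin_cases i <;> fin_cases j <;> simp_all
  have hne : ∀ c ∈ nthRootsFinset n (1 : K), c ≠ 0 := fun c hc =>
    ne_zero_of_mem_nthRootsFinset one_ne_zero hc
  have hcomp : ∀ inst : DecidablePred fun c : K => c = 0,
      @Finset.filter K (fun c => c = 0) inst (nthRootsFinset n (1 : K)) = ∅ := fun _ =>
    Finset.filter_eq_empty_iff.2 hne
  rw [mult_fullMonomial hn]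
  simp only [mk_mem_monomialLine_none, mk_mem_monomialLine_some, Fin.sum_univ_three]
  fin_cases i <;> simp at h0 h1 h2 <;> simp [h0, h1, h2, hcard, hcomp] <;> omega

lemma mult_fullMonomial_one_of_eq [Infinite K] {v : Fin 3 → K} (hv : v ≠ 0)
    (h1 : v 1 = v 0) (h2 : v 2 = v 0) :
    mult (fullMonomial K 1) (Projectivization.mk K v hv) = 3 := by
  have h0 : v 0 ≠ 0 := by
    intro h0
    refine hv (funext fun j => ?_)
    fin_cases j <;> simp_all
  have hroots : nthRootsFinset 1 (1 : K) = {1} := by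
    ext c
    simp [mem_nthRootsFinset]
  rw [mult_fullMonomial one_ne_zero]
  simp [mk_mem_monomialLine_none, mk_mem_monomialLine_some, Fin.sum_univ_three, hroots, h1, h2, h0,
    Finset.filter_singleton]

lemma monomialLine_none_mem_fullMonomial [Infinite K] {n : ℕ} (hn : n ≠ 0) (i : Fin 3) :
    monomialLine i none ∈ fullMonomial K n :=
  (mem_fullMonomial_iff hn).2 ⟨i, Or.inl rfl⟩

lemma monomialLine_some_mem_fullMonomial [Infinite K] {n : ℕ} (hn : n ≠ 0) (i : Fin 3) {c : K}
    (hc : c ^ n = 1) : monomialLine i (some c) ∈ fullMonomial K n :=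
  (mem_fullMonomial_iff hn).2 ⟨i, Or.inr ⟨c, hc, rfl⟩⟩

lemma monomialLine_ne {i j : Fin 3} {o o' : Option K} (h : (i, o) ≠ (j, o')) (ho : o ≠ some 0)
    (ho' : o' ≠ some 0) : (monomialLine i o : Line K) ≠ monomialLine j o' :=
  fun h' => h (monomialLine_injOn (x₁ := (i, o)) (x₂ := (j, o')) ho ho' h')

/-! ### Modular points of the full monomial arrangement -/

/-- A point with exactly one vanishing coordinate is not modular. -/
lemma not_isModularPoint_of_one_zero [Infinite K] {n : ℕ} (hn : n ≠ 0) {v : Fin 3 → K}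
    (hv : v ≠ 0) {i : Fin 3} (h0 : v i = 0) (h1 : v (i + 1) ≠ 0) (h2 : v (i + 2) ≠ 0) :
    ¬ IsModularPoint (fullMonomial K n) (Projectivization.mk K v hv) := by
  intro hmod
  -- The point `e` lies on `x_{i+1} = 0` and `x_{i+2} = x_i`. The only line of the arrangement
  -- through `v` that its zero pattern permits besides `x_i = 0` has the form `x_{i+1} = c x_{i+2}`
  -- with `c ≠ 0`, and `e` is on neither.
  obtain ⟨e, he0, he1, he2⟩ : ∃ e : Fin 3 → K, e i = 1 ∧ e (i + 1) = 0 ∧ e (i + 2) = 1 :=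
    ⟨fun j => if j = i + 1 then 0 else 1, by fin_cases i <;> simp, by simp,
      by fin_cases i <;> simp⟩
  have he : e ≠ 0 := fun h => by simp [h] at he0
  have hI : IsIntersectionPoint (fullMonomial K n) (Projectivization.mk K e he) := by
    refine ⟨_, monomialLine_none_mem_fullMonomial hn (i + 1), _,
      monomialLine_some_mem_fullMonomial hn (i + 1) (one_pow n),
      monomialLine_ne (by simp) (by simp) (by simp), ?_, ?_⟩
    · rwa [mk_mem_monomialLine_none]
    · rw [mk_mem_monomialLine_some]
      fin_cases i <;> simp_all
  obtain ⟨ℓ, hℓ, hp, hq⟩ := hmod.2 _ hI fun heq => by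
    have := (mk_mem_monomialLine_none hv i).2 h0
    rw [← heq, mk_mem_monomialLine_none, he0] at this
    exact one_ne_zero this
  obtain ⟨j, rfl | ⟨c, hc, rfl⟩⟩ := (mem_fullMonomial_iff hn).1 hℓ
  · rw [mk_mem_monomialLine_none] at hp hq
    fin_cases i <;> fin_cases j <;> simp_all
  · have hc0 : c ≠ 0 := by rintro rfl; simp [hn] at hc
    rw [mk_mem_monomialLine_some] at hp hq
    fin_cases i <;> fin_cases j <;> simp_all

/-- For `n ≠ 1`, a point without vanishing coordinates is not modular. -/
lemma not_isModularPoint_of_forall_ne_zero [Infinite K] {n : ℕ} (hn : n ≠ 0) {ζ : K}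
    (hζ : ζ ^ n = 1) (hζ1 : ζ ≠ 1) {v : Fin 3 → K} (hv : v ≠ 0) (h : ∀ i, v i ≠ 0) :
    ¬ IsModularPoint (fullMonomial K n) (Projectivization.mk K v hv) := by
  intro hmod
  -- Of the two roots of unity `1` and `ζ`, at least one differs from `v 1 / v 2`. For that `c`, no
  -- line of the arrangement joins `v` to `(0 : c : 1)`.
  obtain ⟨c, hc, hvc⟩ : ∃ c : K, c ^ n = 1 ∧ v 1 ≠ c * v 2 := by
    by_cases h1 : v 1 = 1 * v 2
    · refine ⟨ζ, hζ, fun h2 => hζ1 (mul_right_cancel₀ (h 2) (h2.symm.trans h1))⟩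
    · exact ⟨1, one_pow n, h1⟩
  have hc0 : c ≠ 0 := by rintro rfl; simp [hn] at hc
  have he : ![0, c, 1] ≠ 0 := fun h => one_ne_zero (congrFun h 2)
  have hI : IsIntersectionPoint (fullMonomial K n) (Projectivization.mk K ![0, c, 1] he) := by
    refine ⟨_, monomialLine_none_mem_fullMonomial hn 0, _,
      monomialLine_some_mem_fullMonomial hn 0 hc,
      monomialLine_ne (by simp) (by simp) (by simpa using hc0), ?_, ?_⟩
    · rw [mk_mem_monomialLine_none]; rfl
    · rw [mk_mem_monomialLine_some]; simp
  obtain ⟨ℓ, hℓ, hp, hq⟩ := hmod.2 _ hI fun heq => by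
    have : (Projectivization.mk K ![0, c, 1] he : Point K) ∈ (monomialLine 0 none : Line K) := by
      rw [mk_mem_monomialLine_none]; rfl
    rw [heq, mk_mem_monomialLine_none] at this
    exact h 0 this
  obtain ⟨j, rfl | ⟨c', hc', rfl⟩⟩ := (mem_fullMonomial_iff hn).1 hℓ
  · rw [mk_mem_monomialLine_none] at hp
    exact h j hp
  · have hc0' : c' ≠ 0 := by rintro rfl; simp [hn] at hc'
    rw [mk_mem_monomialLine_some] at hp hq
    fin_cases j <;> simp_all

lemma eq_of_isIntersectionPoint_fullMonomial_one [Infinite K] {v : Fin 3 → K} (hv : v ≠ 0)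
    (h : ∀ i, v i ≠ 0)
    (hI : IsIntersectionPoint (fullMonomial K 1) (Projectivization.mk K v hv)) :
    v 1 = v 0 ∧ v 2 = v 0 := by
  obtain ⟨ℓ, hℓ, ℓ', hℓ', hne, hp, hp'⟩ := hI
  obtain ⟨i, rfl | ⟨c, hc, rfl⟩⟩ := (mem_fullMonomial_iff one_ne_zero).1 hℓ
  · exact absurd ((mk_mem_monomialLine_none hv i).1 hp) (h i)
  obtain ⟨j, rfl | ⟨c', hc', rfl⟩⟩ := (mem_fullMonomial_iff one_ne_zero).1 hℓ'
  · exact absurd ((mk_mem_monomialLine_none hv j).1 hp') (h j)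
  rw [pow_one] at hc hc'
  subst hc hc'
  rw [mk_mem_monomialLine_some, one_mul] at hp hp'
  fin_cases i <;> fin_cases j <;> simp_all

/-- The line joining the vertex to `v` is `x_1 = (v_1 / v_2) x_2`, so off the coordinate lines
through the vertex the claim is `v_1 ^ n = v_2 ^ n`. Two distinct lines through `v` give it: either
one is of this type, or they relate both coordinates to `v_0` and `v_1 ^ n = v_0 ^ n = v_2 ^ n`. -/
lemma isModularPoint_fullMonomial_vertex [Infinite K] {n : ℕ} (hn : n ≠ 0)
    (he : ![1, 0, 0] ≠ (0 : Fin 3 → K)) :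
    IsModularPoint (fullMonomial K n) (Projectivization.mk K ![1, 0, 0] he) := by
  refine ⟨⟨_, monomialLine_none_mem_fullMonomial hn 1, _,
    monomialLine_none_mem_fullMonomial hn 2, monomialLine_ne (by simp) (by simp) (by simp),
    (mk_mem_monomialLine_none he 1).2 rfl, (mk_mem_monomialLine_none he 2).2 rfl⟩, ?_⟩
  intro q hq _
  induction q using Projectivization.ind with | h v hv =>
  by_cases h1 : v 1 = 0
  · exact ⟨_, monomialLine_none_mem_fullMonomial hn 1, (mk_mem_monomialLine_none he 1).2 rfl,
      (mk_mem_monomialLine_none hv 1).2 h1⟩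
  by_cases h2 : v 2 = 0
  · exact ⟨_, monomialLine_none_mem_fullMonomial hn 2, (mk_mem_monomialLine_none he 2).2 rfl,
      (mk_mem_monomialLine_none hv 2).2 h2⟩
  suffices h : v 1 ^ n = v 2 ^ n by
    refine ⟨_, monomialLine_some_mem_fullMonomial hn 0 (c := v 1 / v 2) ?_,
      (mk_mem_monomialLine_some he 0 _).2 (by simp), (mk_mem_monomialLine_some hv 0 _).2 ?_⟩
    · rw [div_pow, h, div_self (pow_ne_zero _ h2)]
    · exact (div_mul_cancel₀ _ h2).symm
  have hline : ∀ ℓ ∈ fullMonomial K n, (Projectivization.mk K v hv : Point K) ∈ ℓ →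
      v 1 ^ n = v 2 ^ n ∨ (v 0 = 0 ∧ ℓ = monomialLine 0 none) ∨
      (∃ c : K, c ^ n = 1 ∧ v 2 = c * v 0 ∧ ℓ = monomialLine 1 (some c)) ∨
      ∃ c : K, c ^ n = 1 ∧ v 0 = c * v 1 ∧ ℓ = monomialLine 2 (some c) := by
    intro ℓ hℓ hmem
    obtain ⟨i, rfl | ⟨c, hc, rfl⟩⟩ := (mem_fullMonomial_iff hn).1 hℓ
    · rw [mk_mem_monomialLine_none] at hmem
      fin_cases i
      · exact Or.inr (Or.inl ⟨hmem, rfl⟩)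
      · exact absurd hmem h1
      · exact absurd hmem h2
    · rw [mk_mem_monomialLine_some] at hmem
      fin_cases i
      · left
        change v 1 = c * v 2 at hmem
        rw [hmem, mul_pow, hc, one_mul]
      · exact Or.inr (Or.inr (Or.inl ⟨c, hc, hmem, rfl⟩))
      · exact Or.inr (Or.inr (Or.inr ⟨c, hc, hmem, rfl⟩))
  have hc0 : ∀ c : K, c ^ n = 1 → c ≠ 0 := by
    rintro c hc rfl
    simp [hn] at hc
  obtain ⟨ℓ, hℓ, ℓ', hℓ', hne, hp, hp'⟩ := hq
  rcases hline ℓ hℓ hp with h | ⟨h0, rfl⟩ | ⟨c, hc, hvc, rfl⟩ | ⟨c, hc, hvc, rfl⟩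
  · exact h
  · rcases hline ℓ' hℓ' hp' with h | ⟨h0', rfl⟩ | ⟨c, hc, hvc, rfl⟩ | ⟨c, hc, hvc, rfl⟩
    · exact h
    · exact absurd rfl hne
    · exact absurd (by rw [hvc, h0, mul_zero]) h2
    · exact absurd (hvc.symm.trans h0) (mul_ne_zero (hc0 c hc) h1)
  · rcases hline ℓ' hℓ' hp' with h | ⟨h0', rfl⟩ | ⟨c', hc', hvc', rfl⟩ | ⟨c', hc', hvc', rfl⟩
    · exact h
    · exact absurd (by rw [hvc, h0', mul_zero]) h2
    · have h0 : v 0 ≠ 0 := fun h0 => h2 (by rw [hvc, h0, mul_zero])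
      exact absurd (by rw [mul_right_cancel₀ h0 (hvc.symm.trans hvc')]) hne
    · rw [hvc, hvc', mul_pow, mul_pow, hc, hc', one_mul, one_mul]
  · rcases hline ℓ' hℓ' hp' with h | ⟨h0', rfl⟩ | ⟨c', hc', hvc', rfl⟩ | ⟨c', hc', hvc', rfl⟩
    · exact h
    · exact absurd (hvc.symm.trans h0') (mul_ne_zero (hc0 c hc) h1)
    · rw [hvc', hvc, mul_pow, mul_pow, hc, hc', one_mul, one_mul]
    · exact absurd (by rw [mul_right_cancel₀ h1 (hvc.symm.trans hvc')]) hne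

lemma mult_eq_of_isModularPoint_fullMonomial [Infinite K] {n : ℕ} (hn : n ≠ 0) {ζ : K}
    (hζ : IsPrimitiveRoot ζ n) {p : Point K} (hp : IsModularPoint (fullMonomial K n) p) :
    mult (fullMonomial K n) p = n + 2 := by
  induction p using Projectivization.ind with | h v hv =>
  by_cases h : ∀ i, v i ≠ 0
  · by_cases hn1 : n = 1
    · subst hn1
      obtain ⟨h1, h2⟩ := eq_of_isIntersectionPoint_fullMonomial_one hv h hp.1
      exact mult_fullMonomial_one_of_eq hv h1 h2
    · refine absurd hp (not_isModularPoint_of_forall_ne_zero hn hζ.pow_eq_one ?_ hv h)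
      rintro rfl
      exact hn1 (hζ.unique IsPrimitiveRoot.one)
  · push Not at h
    obtain ⟨i, h0⟩ := h
    by_cases h1 : v (i + 1) = 0
    · refine mult_fullMonomial_of_vertex hn hζ.card_nthRootsFinset hv (i := i + 2) ?_ ?_
      · rw [add_assoc]; simpa using h0
      · rw [add_assoc]; simpa using h1
    · by_cases h2 : v (i + 2) = 0
      · refine mult_fullMonomial_of_vertex hn hζ.card_nthRootsFinset hv (i := i + 1) ?_ ?_
        · rw [add_assoc]; simpa using h2
        · rw [add_assoc]; simpa using h0
      · exact absurd hp (not_isModularPoint_of_one_zero hn hv h0 h1 h2)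

end LineArrangement
open LineArrangement in
theorem theorem1p1 {K : Type*} [Field K] [CharZero K] :
    (∀ (A : Set (Line K)), A.Finite → IsSupersolvable A →
      ∀ (p : Point K) (m : ℕ), 2 ≤ m → IsModularPoint A p → mult A p = m →
        (∀ q : Point K, IsModularPoint A q → mult A q ≤ m) →
        A.ncard ≤ 3 * m - 3) ∧
    (∀ m : ℕ, 3 ≤ m → (∃ ζ : K, IsPrimitiveRoot ζ (m - 2)) →
      (fullMonomial K (m - 2)).Finite ∧
        IsHomogeneousSupersolvable (fullMonomial K (m - 2)) m ∧
        (fullMonomial K (m - 2)).ncard = 3 * m - 3) := by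
  refine ⟨fun A hA _ p m hm2 hp hm hmax => ncard_le_of_isModularPoint hA hm2 hp hm hmax, ?_⟩
  rintro m hm ⟨ζ, hζ⟩
  obtain ⟨n, rfl⟩ : ∃ n, m = n + 2 := ⟨m - 2, by omega⟩
  rw [Nat.add_sub_cancel] at hζ ⊢
  have hn : n ≠ 0 := by omega
  refine ⟨finite_fullMonomial hn, ⟨⟨_, isModularPoint_fullMonomial_vertex hn
    fun h => one_ne_zero (congrFun h 0)⟩,
    fun p hp => mult_eq_of_isModularPoint_fullMonomial hn hζ hp⟩, ?_⟩
  rw [ncard_fullMonomial hn hζ.card_nthRootsFinset]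
  omega
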